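/- Let $F$ be a polynomial with real coefficients such that $F(0)>0>F(1)$, and let $V:[0,1]\to\mathbb R$ be a potential of $F$, that is, $V'=-F$ on $[0,1]$. Suppose that all complex zeros of $F$ are real and that every critical point of $V$ in $[0,1]$ is a local minimum or a local maximum of $V$. Let $\mathbb T=\mathbb R/\mathbb Z$. Then, modulo translations, there are only finitely many classical solutions of $$\tfrac12\,\rho''+F(\rho)=0\quad\text{on }\mathbb T,$$ that is, only finitely many functions $\rho\in C^2(\mathbb T)$ with values in $[0,1]$ which satisfy the equation at every point of $\mathbb T$, where $\rho$ and $\rho'$ are identified if there is $\theta'\in\mathbb T$ with $\rho'(\theta)=\rho(\theta+\theta')$ for all $\theta\in\mathbb T$. -/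

import Mathlib

/-- `C²(𝕋)`: the functions `ρ : 𝕋 → ℝ` on the torus `𝕋 = ℝ / ℤ` that are twice continuously
differentiable, that is, whose lift `x ↦ ρ (x mod 1)` to the line is of class `C²`. -/
def TorusC2 : Type := {ρ : UnitAddCircle → ℝ // ContDiff ℝ 2 (fun x : ℝ => ρ (x : UnitAddCircle))}

namespace TorusC2

/-- The `1`-periodic function on the line that corresponds to a function on the torus. -/
def lift (ρ : TorusC2) (x : ℝ) : ℝ := ρ.1 (x : UnitAddCircle)

/-- `ρ ∼ ρ'` if `ρ' (θ) = ρ (θ + θ')` for some `θ' ∈ 𝕋` and all `θ ∈ 𝕋`. -/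
instance translation : Setoid TorusC2 where
  r ρ ρ' := ∃ θ' : UnitAddCircle, ∀ θ : UnitAddCircle, ρ'.1 θ = ρ.1 (θ + θ')
  iseqv :=
    { refl := fun _ => ⟨0, fun θ => by rw [add_zero]⟩
      symm := by
        rintro ρ ρ' ⟨a, h⟩
        exact ⟨-a, fun θ => by rw [h, neg_add_cancel_right]⟩
      trans := by
        rintro ρ ρ' ρ'' ⟨a, h⟩ ⟨b, h'⟩
        exact ⟨b + a, fun θ => by rw [h', h, add_assoc]⟩ }

end TorusC2

/-- The set of classical solutions of `(1/2) Δρ + F(ρ) = 0` on the torus: the `[0,1]`-valued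
functions in `C²(𝕋)` that satisfy the equation at every point. -/
def classicalSolutions (F : Polynomial ℝ) : Set TorusC2 :=
  {ρ | (∀ x : ℝ, ρ.lift x ∈ Set.Icc (0 : ℝ) 1) ∧
    ∀ x : ℝ, (1 / 2 : ℝ) * deriv (deriv ρ.lift) x + F.eval (ρ.lift x) = 0}

/-! Every periodic function has a critical point, by Rolle. Translating it to `0` gives a solution
`u` on `[0,1]` with `u'(0) = 0`, hence of the Volterra equation `u + 2 ∫∫ F(u) = u(0)`. Such a `u`
is determined by `u(0)`, so it suffices that the set `S` of initial values of periodic solutions is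
finite.

`S` is a closed subset of `[0,1]` (`isClosed_initial_values`). Near a point of `S`, the inverse
function theorem gives solutions depending analytically on the initial value `a`, so the defect
`u(1) - u(0)` is analytic in `a`. If its zeros accumulate, it vanishes on a neighbourhood. The signs
of `F` at `0` and `1` keep solutions strictly inside `(0,1)` (`mem_Ioo_of_mem_periodicSolutions`),
so nearby ones stay admissible. Hence `S` contains a neighbourhood of each of its accumulation
points (`eventually_mem_initial_values`). This is impossible at the smallest one, so there is none,
and compactness makes `S` finite. -/

section

open Set Filter Topology unitInterval
open scoped ContDiff

namespace TorusODE

/-! ### Double integration in exponentially weighted norms -/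

/-- Integration from `0`, as a continuous linear operator on `C([0,1], ℝ)`. -/
noncomputable def integral : C(I, ℝ) →L[ℝ] C(I, ℝ) :=
  LinearMap.mkContinuous
    { toFun := fun u =>
        { toFun := fun t => ∫ s in (0 : ℝ)..t, IccExtend zero_le_one u s
          continuous_toFun := by
            have hu : Continuous (IccExtend (zero_le_one' ℝ) u) := u.continuous.Icc_extend'
            exact (intervalIntegral.continuous_primitive
              (fun a b => hu.intervalIntegrable a b) 0).comp continuous_subtype_val }
      map_add' := fun u v => by
        ext t
        exact intervalIntegral.integral_add (u.continuous.Icc_extend'.intervalIntegrable _ _)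
          (v.continuous.Icc_extend'.intervalIntegrable _ _)
      map_smul' := fun c u => by
        ext t
        exact intervalIntegral.integral_const_mul c _ } 1 fun u => by
    rw [ContinuousMap.norm_le _ (by positivity)]
    intro t
    have := intervalIntegral.norm_integral_le_of_norm_le_const (a := (0 : ℝ)) (b := t)
      (f := IccExtend zero_le_one u) (C := ‖u‖) fun s _ => u.norm_coe_le_norm _
    refine this.trans ?_
    rw [sub_zero, abs_of_nonneg t.2.1, one_mul]
    exact mul_le_of_le_one_right (norm_nonneg _) t.2.2

theorem integral_apply (u : C(I, ℝ)) (t : I) :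
    integral u t = ∫ s in (0 : ℝ)..t, IccExtend zero_le_one u s := rfl

theorem integral_zero (u : C(I, ℝ)) : integral u 0 = 0 := by
  simp [integral_apply]

theorem hasDerivAt_primitive (u : C(I, ℝ)) (x : ℝ) :
    HasDerivAt (fun y : ℝ => ∫ s in (0 : ℝ)..y, IccExtend zero_le_one u s)
      (IccExtend zero_le_one u x) x :=
  (u.continuous.Icc_extend' : Continuous (IccExtend (zero_le_one' ℝ) u)).integral_hasStrictDerivAt
    0 x |>.hasDerivAt

/-- The weight `t ↦ exp (- l t)`. -/
noncomputable def weight (l : ℝ) : C(I, ℝ) := ⟨fun t => Real.exp (-(l * t)), by fun_prop⟩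

@[simp] theorem weight_apply (l : ℝ) (t : I) : weight l t = Real.exp (-(l * t)) := rfl

theorem weight_mul_weight_neg (l : ℝ) : weight l * weight (-l) = 1 := by
  ext t
  simp [← Real.exp_add]

theorem abs_integral_le {l m : ℝ} (hl : 0 < l) (hm : 0 ≤ m) {u : C(I, ℝ)}
    (h : ∀ t : I, |u t| ≤ m * Real.exp (l * t)) (t : I) :
    |integral u t| ≤ m / l * Real.exp (l * t) := by
  rw [integral_apply, ← Real.norm_eq_abs]
  have h1 : ‖∫ s in (0 : ℝ)..t, IccExtend zero_le_one u s‖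
      ≤ ∫ s in (0 : ℝ)..t, m * Real.exp (l * s) := by
    refine intervalIntegral.norm_integral_le_of_norm_le t.2.1 ?_
      ((by fun_prop : Continuous fun s : ℝ => m * Real.exp (l * s)).intervalIntegrable _ _)
    refine Eventually.of_forall fun s hs => ?_
    have hs' : s ∈ Icc (0 : ℝ) 1 := ⟨hs.1.le, hs.2.trans t.2.2⟩
    rw [IccExtend_of_mem _ _ hs']
    exact h ⟨s, hs'⟩
  have h2 : ∫ s in (0 : ℝ)..t, m * Real.exp (l * s)
      = m / l * Real.exp (l * t) - m / l * Real.exp (l * 0) := by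
    refine intervalIntegral.integral_eq_sub_of_hasDerivAt
      (f := fun s => m / l * Real.exp (l * s)) (fun s _ => ?_)
      ((by fun_prop : Continuous fun s : ℝ => m * Real.exp (l * s)).intervalIntegrable _ _)
    have := (((hasDerivAt_id s).const_mul l).exp).const_mul (m / l)
    refine this.congr_deriv ?_
    simp only [id]
    field_simp
  refine h1.trans ?_
  rw [h2]
  have : 0 ≤ m / l * Real.exp (l * 0) := by positivity
  linarith

/-- Each integration of `exp (l * t)` gains a factor `1 / l`, so a large `l` makes the Volterra
operator a contraction in the weighted norm. -/
theorem norm_weight_mul_integral_integral_le {l M : ℝ} (hl : 0 < l) (hM : 0 ≤ M) {g h : C(I, ℝ)}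
    (hgh : ∀ t, |h t| ≤ M * |g t|) :
    ‖weight l * integral (integral h)‖ ≤ M / l ^ 2 * ‖weight l * g‖ := by
  have hg : ∀ t : I, |h t| ≤ M * ‖weight l * g‖ * Real.exp (l * t) := by
    intro t
    have h1 : Real.exp (-(l * t)) * |g t| ≤ ‖weight l * g‖ := by
      have := (weight l * g).norm_coe_le_norm t
      simpa [abs_mul] using this
    calc |h t| ≤ M * |g t| := hgh t
      _ = M * (Real.exp (-(l * t)) * |g t|) * Real.exp (l * t) := by
        rw [Real.exp_neg]; field_simp
      _ ≤ _ := by gcongr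
  have h2 := abs_integral_le hl (by positivity) (abs_integral_le hl (by positivity) hg)
  rw [ContinuousMap.norm_le _ (by positivity)]
  intro t
  have := h2 t
  rw [ContinuousMap.mul_apply, weight_apply, norm_mul, Real.norm_eq_abs, Real.norm_eq_abs,
    abs_of_pos (Real.exp_pos _)]
  calc _ ≤ Real.exp (-(l * t)) * (M * ‖weight l * g‖ / l / l * Real.exp (l * t)) := by gcongr
    _ = _ := by rw [Real.exp_neg]; field_simp

/-- A Gronwall estimate for second order Volterra equations. -/
theorem exists_norm_le_of_volterra (M : ℝ) (hM : 0 ≤ M) : ∃ C : ℝ, 0 ≤ C ∧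
    ∀ (c g h : C(I, ℝ)), (∀ t, |h t| ≤ M * |g t|) → g = c + integral (integral h) →
      ‖g‖ ≤ C * ‖c‖ := by
  -- This choice gives `M / l ^ 2 ≤ 1 / 2`, so the integral term can be absorbed on the left.
  set l := 2 * (M + 1) with hl
  have hl0 : 0 < l := by positivity
  have hl2 : M / l ^ 2 ≤ 1 / 2 := by
    rw [div_le_iff₀ (by positivity)]
    nlinarith
  refine ⟨‖weight (-l)‖ * (2 * ‖weight l‖), by positivity, fun c g h hgh hg => ?_⟩
  have h1 := norm_weight_mul_integral_integral_le hl0 hM hgh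
  have h2 : ‖weight l * g‖ ≤ ‖weight l‖ * ‖c‖ + 1 / 2 * ‖weight l * g‖ := by
    calc ‖weight l * g‖ = ‖weight l * c + weight l * integral (integral h)‖ := by
          rw [← mul_add, ← hg]
      _ ≤ ‖weight l * c‖ + ‖weight l * integral (integral h)‖ := norm_add_le _ _
      _ ≤ ‖weight l‖ * ‖c‖ + M / l ^ 2 * ‖weight l * g‖ := add_le_add (norm_mul_le _ _) h1
      _ ≤ _ := by gcongr
  calc ‖g‖ = ‖weight (-l) * (weight l * g)‖ := by
        rw [← mul_assoc, mul_comm (weight (-l)), weight_mul_weight_neg, one_mul]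
    _ ≤ ‖weight (-l)‖ * ‖weight l * g‖ := norm_mul_le _ _
    _ ≤ ‖weight (-l)‖ * (2 * (‖weight l‖ * ‖c‖)) := by gcongr; linarith
    _ = _ := by ring

/-- Multiplication by a fixed function. -/
noncomputable abbrev mulOp (q : C(I, ℝ)) : C(I, ℝ) →L[ℝ] C(I, ℝ) := ContinuousLinearMap.mul ℝ _ q

/-- The Volterra operators `1 - ∫∫ q` are invertible. -/
theorem isUnit_one_sub_volterra (q : C(I, ℝ)) :
    IsUnit (1 - integral * integral * mulOp q) := by
  set l := ‖q‖ + 1 with hl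
  have hl0 : 0 < l := by positivity
  have hinv (k : ℝ) : mulOp (weight k) * mulOp (weight (-k)) = 1 := by
    ext1 u
    simp [← mul_assoc, weight_mul_weight_neg]
  let E : (C(I, ℝ) →L[ℝ] C(I, ℝ))ˣ := ⟨mulOp (weight l), mulOp (weight (-l)), hinv l, by
    simpa using hinv (-l)⟩
  -- The operator itself need not have norm below `1`. Its conjugate by the weight does, and the
  -- Neumann series applies to that.
  have hlt : ‖(E : C(I, ℝ) →L[ℝ] C(I, ℝ)) * (integral * integral * mulOp q) * (↑E⁻¹ :
      C(I, ℝ) →L[ℝ] C(I, ℝ))‖ < 1 := by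
    have hb : ‖q‖ / l ^ 2 < 1 := by
      rw [div_lt_one (by positivity)]
      nlinarith [norm_nonneg q]
    refine lt_of_le_of_lt (ContinuousLinearMap.opNorm_le_bound _ (by positivity) fun u => ?_) hb
    have h1 := norm_weight_mul_integral_integral_le hl0 (norm_nonneg q)
      (g := weight (-l) * u) (h := q * (weight (-l) * u)) fun t => by
        rw [ContinuousMap.mul_apply, abs_mul]
        gcongr
        exact q.norm_coe_le_norm t
    rw [← mul_assoc (weight l) (weight (-l)), weight_mul_weight_neg, one_mul] at h1
    exact h1
  have hu := isUnit_one_sub_of_norm_lt_one (R := C(I, ℝ) →L[ℝ] C(I, ℝ)) hlt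
  have : 1 - integral * integral * mulOp q = (↑E⁻¹ : C(I, ℝ) →L[ℝ] C(I, ℝ)) *
      (1 - E * (integral * integral * mulOp q) * (↑E⁻¹ : C(I, ℝ) →L[ℝ] C(I, ℝ))) * E := by
    simp [mul_sub, sub_mul, mul_assoc]
  rw [this]
  exact (E⁻¹.isUnit.mul hu).mul E.isUnit

/-! ### The Volterra equation and its periodic solutions -/

/-- The Nemytskii operator of a polynomial. -/
theorem contDiff_aeval (F : Polynomial ℝ) :
    ContDiff ℝ ω (fun u : C(I, ℝ) => Polynomial.aeval u F) := by
  induction F using Polynomial.induction_on' with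
  | add p q hp hq => simpa using hp.add hq
  | monomial n c =>
    simp only [Polynomial.aeval_monomial]
    exact contDiff_const.mul (contDiff_id.pow n)

theorem hasFDerivAt_aeval (F : Polynomial ℝ) (u : C(I, ℝ)) :
    HasFDerivAt (fun u : C(I, ℝ) => Polynomial.aeval u F)
      (mulOp (Polynomial.aeval u F.derivative)) u := by
  induction F using Polynomial.induction_on' with
  | add p q hp hq =>
    simp only [map_add]
    exact hp.add hq
  | monomial n c =>
    simp only [Polynomial.aeval_monomial, Polynomial.derivative_monomial]
    refine (((hasFDerivAt_id (𝕜 := ℝ) u).pow n).const_mul (algebraMap ℝ C(I, ℝ) c)).congr_fderiv ?_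
    ext1 v
    simp [Algebra.smul_def]
    ring

theorem aeval_apply (F : Polynomial ℝ) (u : C(I, ℝ)) (t : I) :
    (Polynomial.aeval u F) t = F.eval (u t) := by
  have := Polynomial.aeval_algHom_apply (ContinuousMap.evalAlgHom ℝ ℝ t) u F
  exact this.symm

theorem eval_sub_le_on_unitInterval (F : Polynomial ℝ) : ∃ M : ℝ, 0 ≤ M ∧
    ∀ x ∈ Icc (0 : ℝ) 1, ∀ y ∈ Icc (0 : ℝ) 1, |F.eval x - F.eval y| ≤ M * |x - y| := by
  obtain ⟨M, hM⟩ := (isCompact_Icc (a := (0 : ℝ)) (b := 1)).exists_bound_of_continuousOn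
    F.derivative.continuous.continuousOn
  refine ⟨M, (norm_nonneg _).trans (hM 0 (by simp)), fun x hx y hy => ?_⟩
  exact (convex_Icc (0 : ℝ) 1).norm_image_sub_le_of_norm_deriv_le
    (fun z _ => F.differentiable z) (fun z hz => by rw [F.deriv]; exact hM z hz) hy hx

/-- The operator `u ↦ u + 2 ∫∫ F(u)`, which is constant exactly at the solutions of
`u'' / 2 + F(u) = 0` that have `u'(0) = 0`. -/
noncomputable def volterraMap (F : Polynomial ℝ) (u : C(I, ℝ)) : C(I, ℝ) :=
  u + (2 : ℝ) • integral (integral (Polynomial.aeval u F))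

theorem contDiff_volterraMap (F : Polynomial ℝ) : ContDiff ℝ ω (volterraMap F) :=
  contDiff_id.add (((integral.comp integral).contDiff.comp (contDiff_aeval F)).const_smul (2 : ℝ))

/-- The derivative is `1 + 2 ∫∫ F'(u)`, again of Volterra type. Its invertibility is what the
inverse function theorem needs. -/
theorem exists_hasFDerivAt_volterraMap (F : Polynomial ℝ) (u : C(I, ℝ)) :
    ∃ A : C(I, ℝ) ≃L[ℝ] C(I, ℝ),
      HasFDerivAt (volterraMap F) (A : C(I, ℝ) →L[ℝ] C(I, ℝ)) u := by
  obtain ⟨U, hU⟩ := isUnit_one_sub_volterra (-(2 : ℝ) • Polynomial.aeval u F.derivative)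
  refine ⟨ContinuousLinearEquiv.ofUnit U, ?_⟩
  have h := (hasFDerivAt_id (𝕜 := ℝ) u).add
    ((((integral.comp integral).hasFDerivAt).comp u (hasFDerivAt_aeval F u)).const_smul (2 : ℝ))
  refine h.congr_fderiv ?_
  change _ = (U : C(I, ℝ) →L[ℝ] C(I, ℝ))
  rw [hU]
  ext1 v
  simp [mulOp]

/-- The `[0,1]`-valued solutions of `u'' / 2 + F(u) = 0` on `[0,1]` with `u'(0) = 0` and
`u(1) = u(0)`. -/
def periodicSolutions (F : Polynomial ℝ) : Set C(I, ℝ) :=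
  {u | volterraMap F u = u 0 • (1 : C(I, ℝ)) ∧ (∀ t, u t ∈ Icc (0 : ℝ) 1) ∧ u 1 = u 0}

theorem isClosed_periodicSolutions (F : Polynomial ℝ) : IsClosed (periodicSolutions F) := by
  have h : periodicSolutions F = {u | volterraMap F u = u 0 • (1 : C(I, ℝ))} ∩
      ((⋂ t : I, {u | u t ∈ Icc (0 : ℝ) 1}) ∩ {u | u 1 = u 0}) := by
    ext u
    simp [periodicSolutions]
  rw [h]
  exact (isClosed_eq (contDiff_volterraMap F).continuous (by fun_prop)).inter
    ((isClosed_iInter fun t => isClosed_Icc.preimage (by fun_prop)).inter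
      (isClosed_eq (by fun_prop) (by fun_prop)))

/-- `F` is Lipschitz on `[0,1]`, so the Gronwall estimate applies to `u - w`. -/
theorem exists_norm_sub_le (F : Polynomial ℝ) : ∃ C : ℝ, 0 ≤ C ∧
    ∀ u ∈ periodicSolutions F, ∀ w ∈ periodicSolutions F, ‖u - w‖ ≤ C * |u 0 - w 0| := by
  obtain ⟨M, hM, hF⟩ := eval_sub_le_on_unitInterval F
  obtain ⟨C, hC, h⟩ := exists_norm_le_of_volterra (2 * M) (by positivity)
  refine ⟨C, hC, fun u hu w hw => ?_⟩
  have := h ((u 0 - w 0) • 1) (u - w)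
    (-(2 : ℝ) • (Polynomial.aeval u F - Polynomial.aeval w F)) (fun t => ?_) ?_
  · simpa [norm_smul] using this
  · have := hF _ (hu.2.1 t) _ (hw.2.1 t)
    simp only [ContinuousMap.smul_apply, ContinuousMap.sub_apply, aeval_apply, smul_eq_mul, abs_mul,
      abs_neg, abs_two]
    linarith
  · rw [sub_smul, ← hu.1, ← hw.1]
    simp only [volterraMap, map_smul, map_sub]
    module

/-- Evaluation at `0` is antilipschitz on the complete space of periodic solutions, so its range is
closed. -/
theorem isClosed_initial_values (F : Polynomial ℝ) :
    IsClosed ((fun u : C(I, ℝ) => u 0) '' periodicSolutions F) := by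
  obtain ⟨C, hC, h⟩ := exists_norm_sub_le F
  have : CompleteSpace (periodicSolutions F) := (isClosed_periodicSolutions F).completeSpace_coe
  rw [image_eq_range]
  refine AntilipschitzWith.isClosed_range (K := ⟨C, hC⟩) ?_ ?_
  · refine AntilipschitzWith.of_le_mul_dist fun u w => ?_
    rw [Subtype.dist_eq, dist_eq_norm, Real.dist_eq]
    exact h u u.2 w w.2
  · exact (ContinuousMap.evalCLM ℝ (0 : I) : C(I, ℝ) →L[ℝ] ℝ).uniformContinuous.comp
      uniformContinuous_subtype_val

/-! ### Maximum principle -/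

/-- Zero slope and negative second derivative force a decrease to the right. Being one-sided, the
argument also covers `t = 0`. -/
theorem exists_integral_integral_lt {f : C(I, ℝ)} {t : I} (ht : t < 1) (h0 : integral f t = 0)
    (hf : f t < 0) : ∃ s, integral (integral f) s < integral (integral f) t := by
  have hc : Continuous (IccExtend (zero_le_one' ℝ) f) := f.continuous.Icc_extend'
  have hft : IccExtend (zero_le_one' ℝ) f t < 0 := by rwa [IccExtend_val]
  obtain ⟨b, hb, hfb⟩ := exists_Ico_subset_of_mem_nhds (hc.continuousAt.eventually_lt_const hft)
    ⟨1, show (t : ℝ) < 1 from ht⟩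
  obtain ⟨s, hts, hs⟩ := exists_between (lt_min hb (show (t : ℝ) < 1 from ht))
  have hs1 : s ∈ Icc (0 : ℝ) 1 := ⟨t.2.1.trans hts.le, hs.le.trans (min_le_right _ _)⟩
  have hv : StrictAntiOn (fun y : ℝ => ∫ r in (0 : ℝ)..y, IccExtend zero_le_one f r)
      (Icc (t : ℝ) s) := by
    refine strictAntiOn_of_deriv_neg (convex_Icc _ _)
      (fun x _ => (hasDerivAt_primitive f x).continuousAt.continuousWithinAt) fun x hx => ?_
    rw [interior_Icc] at hx
    rw [(hasDerivAt_primitive f x).deriv]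
    exact hfb ⟨hx.1.le, hx.2.trans (hs.trans_le (min_le_left _ _))⟩
  have hu : StrictAntiOn (fun y : ℝ => ∫ r in (0 : ℝ)..y, IccExtend zero_le_one (integral f) r)
      (Icc (t : ℝ) s) := by
    refine strictAntiOn_of_deriv_neg (convex_Icc _ _)
      (fun x _ => (hasDerivAt_primitive _ x).continuousAt.continuousWithinAt) fun x hx => ?_
    rw [interior_Icc] at hx
    rw [(hasDerivAt_primitive _ x).deriv, IccExtend_of_mem _ _
      ⟨t.2.1.trans hx.1.le, hx.2.le.trans hs1.2⟩]
    have := hv (left_mem_Icc.2 hts.le) ⟨hx.1.le, hx.2.le⟩ hx.1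
    exact this.trans_eq h0
  exact ⟨⟨s, hs1⟩, hu (left_mem_Icc.2 hts.le) (right_mem_Icc.2 hts.le) hts⟩

/-- The second derivative of a periodic function is nonnegative at a minimum. -/
theorem nonneg_of_isMin {f : C(I, ℝ)} (hf : f 1 = f 0) (h2 : integral (integral f) 1 = 0) {t : I}
    (ht : ∀ s, integral (integral f) t ≤ integral (integral f) s) : 0 ≤ f t := by
  have key : ∀ t : I, t < 1 → (∀ s, integral (integral f) t ≤ integral (integral f) s) →
      0 ≤ f t := by
    intro t ht1 ht
    by_contra! hneg
    have h0 : integral f t = 0 := by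
      rcases eq_or_lt_of_le (unitInterval.nonneg' (t := t)) with h | h
      · rw [← h, integral_zero]
      · have hd := hasDerivAt_primitive (integral f) t
        rw [IccExtend_val] at hd
        refine IsLocalMin.hasDerivAt_eq_zero ?_ hd
        filter_upwards [Icc_mem_nhds (show (0 : ℝ) < t from h) (show (t : ℝ) < 1 from ht1)]
          with x hx using ht ⟨x, hx⟩
    obtain ⟨s, hs⟩ := exists_integral_integral_lt ht1 h0 hneg
    exact (ht s).not_gt hs
  -- By periodicity a minimum at `1` is also one at `0`, where the slope vanishes by construction.
  rcases eq_or_lt_of_le (unitInterval.le_one' (t := t)) with h | h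
  · rw [h] at ht ⊢
    rw [hf]
    refine key 0 zero_lt_one fun s => ?_
    rw [integral_zero, ← h2]
    exact ht s
  · exact key t h ht

/-- A solution touching `0` has a minimum there with `u'' = -2 F(0) < 0`. At `1` the signs are
reversed. -/
theorem mem_Ioo_of_mem_periodicSolutions {F : Polynomial ℝ} (hF0 : 0 < F.eval 0)
    (hF1 : F.eval 1 < 0) {u : C(I, ℝ)} (hu : u ∈ periodicSolutions F) (t : I) :
    u t ∈ Ioo (0 : ℝ) 1 := by
  obtain ⟨hV, hI, hp⟩ := hu
  set f := Polynomial.aeval u F with hf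
  have hut : ∀ t, u t + 2 * integral (integral f) t = u 0 := fun t => by
    simpa [volterraMap] using congrArg (fun v : C(I, ℝ) => v t) hV
  have hf1 : f 1 = f 0 := by simp [hf, hp]
  have hdd : integral (integral f) 1 = 0 := by have := hut 1; linarith
  refine ⟨lt_of_le_of_ne (hI t).1 fun h => ?_, lt_of_le_of_ne (hI t).2 fun h => ?_⟩
  · have := nonneg_of_isMin (f := -f) (t := t) (by simp [hf1]) (by simp [hdd])
      fun s => by
        have h1 := hut t
        have h2 := hut s
        have h3 := (hI s).1
        simp only [map_neg, ContinuousMap.neg_apply]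
        linarith
    rw [ContinuousMap.neg_apply, hf, aeval_apply, ← h] at this
    linarith
  · have := nonneg_of_isMin (f := f) (t := t) hf1 hdd fun s => by
      have h1 := hut t
      have h2 := hut s
      have h3 := (hI s).2
      linarith
    rw [hf, aeval_apply, h] at this
    linarith

/-! ### Analytic dependence and finiteness -/

/-- If the initial values of periodic solutions accumulate at one of them, then they fill a
neighbourhood of it, because the solution depends analytically on the initial value. -/
theorem eventually_mem_initial_values {F : Polynomial ℝ} (hF0 : 0 < F.eval 0) (hF1 : F.eval 1 < 0)
    {u : C(I, ℝ)} (hu : u ∈ periodicSolutions F)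
    (hacc : ∃ᶠ a in 𝓝[≠] (u 0), a ∈ (fun u : C(I, ℝ) => u 0) '' periodicSolutions F) :
    ∀ᶠ a in 𝓝 (u 0), a ∈ (fun u : C(I, ℝ) => u 0) '' periodicSolutions F := by
  obtain ⟨C, hC, hlip⟩ := exists_norm_sub_le F
  obtain ⟨A, hA⟩ := exists_hasFDerivAt_volterraMap F u
  have hΦ : ContDiffAt ℝ ω (volterraMap F) u := (contDiff_volterraMap F).contDiffAt
  have hω : (ω : WithTop ℕ∞) ≠ 0 := by simp
  have hs := hΦ.hasStrictFDerivAt' hA hω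
  set ψ : C(I, ℝ) → C(I, ℝ) := hs.localInverse (volterraMap F) A u with hψ
  have hψc : ContDiffAt ℝ ω ψ (volterraMap F u) := hΦ.to_localInverse hA hω
  have hψu : ψ (volterraMap F u) = u := hs.localInverse_apply_image
  have hl : ∀ᶠ w in 𝓝 u, ψ (volterraMap F w) = w := hs.eventually_left_inverse
  have hr : ∀ᶠ w in 𝓝 (volterraMap F u), volterraMap F (ψ w) = w := hs.eventually_right_inverse
  rw [hu.1] at hψc hψu hr
  have hcst : ContDiff ℝ ω fun a : ℝ => a • (1 : C(I, ℝ)) := contDiff_id.smul contDiff_const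
  set γ : ℝ → C(I, ℝ) := fun a => ψ (a • (1 : C(I, ℝ))) with hγ
  have hγc : ContDiffAt ℝ ω γ (u 0) := hψc.comp (u 0) hcst.contDiffAt
  -- A periodic solution with initial value near `u 0` is uniformly near `u`, so it is the one found
  -- by the local inverse.
  have hsol : ∃ᶠ a in 𝓝[≠] (u 0), γ a ∈ periodicSolutions F := by
    obtain ⟨ε, hε, hball⟩ := Metric.eventually_nhds_iff.1 hl
    have hnear : ∀ᶠ a in 𝓝[≠] (u 0), C * |a - u 0| < ε := by
      refine Eventually.filter_mono nhdsWithin_le_nhds ?_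
      have : Continuous fun a : ℝ => C * |a - u 0| := by fun_prop
      exact this.continuousAt.eventually_lt_const (by simpa using hε)
    refine (hacc.and_eventually hnear).mono ?_
    rintro _ ⟨⟨w, hw, rfl⟩, hwε⟩
    have := hball (show dist w u < ε by
      rw [dist_eq_norm]; exact (hlip w hw u hu).trans_lt hwε)
    rw [hw.1] at this
    simpa only [hγ, this] using hw
  -- Identity theorem for the analytic defect.
  have h1 : ∀ᶠ a in 𝓝 (u 0), γ a 1 - γ a 0 = 0 := by
    have hev : ContDiff ℝ ω fun v : C(I, ℝ) => v 1 - v 0 :=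
      (ContinuousMap.evalCLM ℝ (1 : I) - ContinuousMap.evalCLM ℝ (0 : I) : C(I, ℝ) →L[ℝ] ℝ).contDiff
    have : AnalyticAt ℝ (fun a => γ a 1 - γ a 0) (u 0) :=
      (hev.contDiffAt.comp (u 0) hγc).analyticAt
    exact this.frequently_zero_iff_eventually_zero.1 (hsol.mono fun a ha => sub_eq_zero.2 ha.2.2)
  have h2 : ∀ᶠ a in 𝓝 (u 0), MapsTo (γ a) univ (Ioo 0 1) := by
    have : Tendsto γ (𝓝 (u 0)) (𝓝 u) := by
      have := hγc.continuousAt.tendsto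
      rwa [show γ (u 0) = u from hψu] at this
    exact this.eventually (ContinuousMap.eventually_mapsTo isCompact_univ isOpen_Ioo
      fun t _ => mem_Ioo_of_mem_periodicSolutions hF0 hF1 hu t)
  have h3 : ∀ᶠ a in 𝓝 (u 0), volterraMap F (γ a) = a • (1 : C(I, ℝ)) :=
    hcst.continuous.continuousAt.eventually hr
  filter_upwards [h1, h2, h3] with a h1 h2 h3
  have h0 : γ a 0 = a := by
    simpa [volterraMap, integral_zero] using congrArg (fun v : C(I, ℝ) => v 0) h3
  exact ⟨γ a, ⟨by rw [h3, h0], fun t => Ioo_subset_Icc_self (h2 (mem_univ t)), sub_eq_zero.1 h1⟩,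
    h0⟩

/-- There are only finitely many solutions: otherwise the smallest accumulation point of their
initial values would have smaller accumulation points next to it. Only the signs of `F` at `0` and
`1` matter, as they keep the solutions away from the boundary of `[0,1]`. -/
theorem finite_periodicSolutions {F : Polynomial ℝ} (hF0 : 0 < F.eval 0) (hF1 : F.eval 1 < 0) :
    (periodicSolutions F).Finite := by
  set S := (fun u : C(I, ℝ) => u 0) '' periodicSolutions F with hS
  have hSI : S ⊆ Icc 0 1 := by
    rintro _ ⟨u, hu, rfl⟩
    exact hu.2.1 0
  have hDS : derivedSet S ⊆ S := (isClosed_iff_derivedSet_subset S).1 (isClosed_initial_values F)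
  have hfin : S.Finite := by
    by_contra hinf
    obtain ⟨x, -, hx⟩ := Set.Infinite.exists_accPt_of_subset_isCompact hinf isCompact_Icc hSI
    have hcomp : IsCompact (derivedSet S) :=
      isCompact_Icc.of_isClosed_subset (isClosed_derivedSet S) (hDS.trans hSI)
    obtain ⟨a, ha, hmin⟩ := hcomp.exists_isLeast ⟨x, hx⟩
    obtain ⟨u, hu, rfl⟩ := hDS ha
    have hev := eventually_mem_initial_values hF0 hF1 hu (accPt_iff_frequently_nhdsNE.1 ha)
    obtain ⟨b, hb, hbS⟩ := ((frequently_lt_nhds (u 0)).and_eventually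
      hev.eventually_nhds).exists
    have : AccPt b (𝓟 S) := accPt_iff_frequently_nhdsNE.2
      (hbS.filter_mono nhdsWithin_le_nhds).frequently
    exact (hmin this).not_gt hb
  refine hfin.of_finite_image fun u hu w hw h => ?_
  obtain ⟨C, -, hlip⟩ := exists_norm_sub_le F
  have h' : u 0 = w 0 := h
  have := hlip u hu w hw
  rw [h', sub_self, abs_zero, mul_zero] at this
  exact sub_eq_zero.1 (norm_le_zero_iff.1 this)

/-! ### Passage from the torus to the interval -/

theorem lift_add_one (ρ : TorusC2) (x : ℝ) : ρ.lift (x + 1) = ρ.lift x := by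
  simp [TorusC2.lift]

theorem contDiff_lift (ρ : TorusC2) : ContDiff ℝ 2 ρ.lift := ρ.2

/-- The restriction to `[0,1]` of a translate of `ρ`. -/
def restrict (ρ : TorusC2) (x₀ : ℝ) : C(I, ℝ) :=
  ⟨fun t => ρ.lift (x₀ + t), by
    have := (contDiff_lift ρ).continuous
    fun_prop⟩

@[simp] theorem restrict_apply (ρ : TorusC2) (x₀ : ℝ) (t : I) :
    restrict ρ x₀ t = ρ.lift (x₀ + t) := rfl

theorem exists_deriv_lift_eq_zero (ρ : TorusC2) : ∃ x₀, deriv ρ.lift x₀ = 0 := by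
  obtain ⟨c, -, hc⟩ := exists_deriv_eq_zero (f := ρ.lift) zero_lt_one
    (contDiff_lift ρ).continuous.continuousOn (by rw [← lift_add_one ρ 0, zero_add])
  exact ⟨c, hc⟩

theorem integral_eq_sub {g : ℝ → ℝ} (f : C(I, ℝ)) (x₀ : ℝ)
    (h : ∀ t : I, HasDerivAt g (f t) (x₀ + t)) (t : I) : integral f t = g (x₀ + t) - g x₀ := by
  have key := intervalIntegral.integral_eq_sub_of_hasDerivAt (a := 0) (b := (t : ℝ))
    (f := fun s => g (x₀ + s)) (f' := IccExtend zero_le_one f) (fun s hs => ?_)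
    ((f.continuous.Icc_extend' : Continuous (IccExtend (zero_le_one' ℝ) f)).intervalIntegrable _ _)
  · rw [integral_apply, key, add_zero]
  · rw [uIcc_of_le t.2.1] at hs
    have hs' : s ∈ Icc (0 : ℝ) 1 := ⟨hs.1, hs.2.trans t.2.2⟩
    rw [IccExtend_of_mem _ _ hs']
    exact (h ⟨s, hs'⟩).comp_const_add x₀ s

theorem restrict_mem_periodicSolutions {F : Polynomial ℝ} {ρ : TorusC2}
    (hρ : ρ ∈ classicalSolutions F) {x₀ : ℝ} (hx₀ : deriv ρ.lift x₀ = 0) :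
    restrict ρ x₀ ∈ periodicSolutions F := by
  have hC : ContDiff ℝ (1 + 1) ρ.lift := by
    rw [one_add_one_eq_two]
    exact contDiff_lift ρ
  have hC1 : ContDiff ℝ 1 (deriv ρ.lift) := (contDiff_succ_iff_deriv.1 hC).2.2
  have h1 : ∀ x, HasDerivAt ρ.lift (deriv ρ.lift x) x := fun x =>
    ((contDiff_lift ρ).differentiable (by norm_num) x).hasDerivAt
  have h2 : ∀ x, HasDerivAt (deriv ρ.lift) (-2 * F.eval (ρ.lift x)) x := fun x => by
    refine ((hC1.differentiable (by norm_num) x).hasDerivAt).congr_deriv ?_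
    have := hρ.2 x
    linarith
  have hI1 : ∀ t : I, integral ((-2 : ℝ) • Polynomial.aeval (restrict ρ x₀) F) t
      = deriv ρ.lift (x₀ + t) := fun t => by
    rw [integral_eq_sub (g := deriv ρ.lift) _ x₀ (fun s => ?_) t, hx₀, sub_zero]
    refine (h2 _).congr_deriv ?_
    rw [ContinuousMap.smul_apply, aeval_apply, restrict_apply, smul_eq_mul]
  have hI2 : ∀ t : I, integral (integral ((-2 : ℝ) • Polynomial.aeval (restrict ρ x₀) F)) t
      = ρ.lift (x₀ + t) - ρ.lift x₀ := fun t =>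
    integral_eq_sub (g := ρ.lift) _ x₀ (fun s => (h1 _).congr_deriv (hI1 s).symm) t
  refine ⟨?_, fun t => hρ.1 _, ?_⟩
  · ext t
    have := hI2 t
    simp only [map_smul, ContinuousMap.smul_apply, smul_eq_mul] at this
    simp only [volterraMap, ContinuousMap.add_apply, ContinuousMap.smul_apply, smul_eq_mul,
      restrict_apply, ContinuousMap.one_apply, mul_one, Set.Icc.coe_zero, add_zero]
    linarith
  · simp [lift_add_one]

/-- The interval `[0,1]` covers a full period, so the restrictions determine the functions up to the
shift `x₀ - x₁`. -/
theorem equiv_of_restrict_eq {ρ ρ' : TorusC2} {x₀ x₁ : ℝ} (h : restrict ρ x₀ = restrict ρ' x₁) :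
    ρ ≈ ρ' := by
  refine ⟨((x₀ - x₁ : ℝ) : UnitAddCircle), fun θ => ?_⟩
  obtain ⟨y, hy⟩ := QuotientAddGroup.mk_surjective (θ - (x₁ : UnitAddCircle))
  have hy' : θ = ((x₁ + Int.fract y : ℝ) : UnitAddCircle) := by
    have hfl : ((⌊y⌋ : ℝ) : UnitAddCircle) = 0 :=
      (AddCircle.coe_eq_zero_iff 1).2 ⟨⌊y⌋, by simp⟩
    have hfr : ((Int.fract y : ℝ) : UnitAddCircle) = (y : UnitAddCircle) := by
      rw [← Int.self_sub_floor, AddCircle.coe_sub, hfl, sub_zero]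
    rw [AddCircle.coe_add, hfr]
    exact (sub_eq_iff_eq_add'.1 hy.symm)
  have := congrArg (fun u : C(I, ℝ) =>
    u ⟨Int.fract y, Int.fract_nonneg y, (Int.fract_lt_one y).le⟩) h
  simp only [restrict_apply, TorusC2.lift] at this
  rw [hy', ← this, ← AddCircle.coe_add]
  exact congrArg (fun x : ℝ => ρ.1 (x : UnitAddCircle)) (by ring)

end TorusODE

end

theorem lemma2p2 (F : Polynomial ℝ) (hF0 : 0 < F.eval 0) (hF1 : F.eval 1 < 0)
    (V : ℝ → ℝ)
    (hV : ∀ x ∈ Set.Icc (0 : ℝ) 1, HasDerivWithinAt V (-(F.eval x)) (Set.Icc 0 1) x)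
    (hreal : ∀ z : ℂ, Polynomial.aeval z F = 0 → z.im = 0)
    (hcrit : ∀ x ∈ Set.Icc (0 : ℝ) 1, derivWithin V (Set.Icc 0 1) x = 0 →
      IsLocalMinOn V (Set.Icc 0 1) x ∨ IsLocalMaxOn V (Set.Icc 0 1) x) :
    ((fun ρ : TorusC2 => Quotient.mk TorusC2.translation ρ) '' classicalSolutions F).Finite := by
  choose x₀ hx₀ using TorusODE.exists_deriv_lift_eq_zero
  have hfin : ((fun ρ => TorusODE.restrict ρ (x₀ ρ)) '' classicalSolutions F).Finite :=
    (TorusODE.finite_periodicSolutions hF0 hF1).subset <| by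
      rintro _ ⟨ρ, hρ, rfl⟩
      exact TorusODE.restrict_mem_periodicSolutions hρ (hx₀ ρ)
  -- Keep one solution `ρ` for each restriction that occurs; every other solution is a translate of
  -- one of these.
  obtain ⟨s, hs, hbij⟩ := Set.SurjOn.exists_bijOn_subset
    (Set.surjOn_image (fun ρ => TorusODE.restrict ρ (x₀ ρ)) (classicalSolutions F))
  have hsfin : s.Finite := hbij.finite_iff_finite.2 hfin
  refine (hsfin.image (Quotient.mk TorusC2.translation)).subset ?_
  rintro _ ⟨ρ, hρ, rfl⟩
  obtain ⟨ρ', hρ', h⟩ := hbij.surjOn ⟨ρ, hρ, rfl⟩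
  exact ⟨ρ', hρ', Quotient.sound (TorusODE.equiv_of_restrict_eq h)⟩
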